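/- **Setting.** Let $k\ge 0$ be an integer and put $\hat k=k+1$ if $k$ is even and $\hat k=k$ if $k$ is odd. Let $\varepsilon,\sigma,\beta>0$, let $N\ge 4$ be an integer divisible by $4$, and let $\tau=\min\{\sigma\sqrt{\varepsilon}\,\beta^{-1}\ln N,\ 1/4\}$. The Shishkin mesh points are $$x_i=y_i=\begin{cases}4\tau iN^{-1}, & 0\le i\le N/4,\\ \tau+2(1-2\tau)(iN^{-1}-1/4), & N/4<i\le 3N/4,\\ 1-4\tau(1-iN^{-1}), & 3N/4<i\le N.\end{cases}$$ Write $h_i=x_i-x_{i-1}$, $I_i=(x_{i-1},x_i)$, $J_j=(y_{j-1},y_j)$ and $K_{ij}=I_i\times J_j$ for $1\le i,j\le N$. Let $\mathcal Q^k(K_{ij})$ be the space of polynomials on $K_{ij}$ of degree at most $k$ in each of the two variables, and let $\mathcal V_N$ be the set of $v\in L^2((0,1)^2)$ such that $v|_{K_{ij}}\in\mathcal Q^k(K_{ij})$ for all $i,j$. On each $K_{ij}$ let $\Pi z\in\mathcal Q^k(K_{ij})$ be the $L^2(K_{ij})$-projection of $z$, i.e. $\int_{K_{ij}}(\Pi z)\,w=\int_{K_{ij}}z\,w$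 for all $w\in\mathcal Q^k(K_{ij})$. For $1\le i\le N-1$ and $y\in J_j$ set $v^{\pm}_{i,y}=\lim_{x\to x_i^{\pm}}v(x,y)$, $[\![v]\!]_{i,y}=v^+_{i,y}-v^-_{i,y}$ and $\{\!\{v\}\!\}_{i,y}=\frac12(v^+_{i,y}+v^-_{i,y})$; for $1\le j\le N-1$ and $x\in I_i$ define $v^\pm_{x,j}=\lim_{y\to y_j^\pm}v(x,y)$, $[\![v]\!]_{x,j}$ and $\{\!\{v\}\!\}_{x,j}$ in the same way. Finally, $\|\cdot\|_D$ denotes the $L^2(D)$ norm. **Lemma.** For every integer $k\ge 0$ there is a constant $C>0$, depending only on $k$ (so independent of $\varepsilon,\sigma,\beta,N,i,j,z,v$), such that the following holds for every mesh as above. 1. If $1\le i\le N-1$, $1\le j\le N$, $h_i=h_{i+1}$ and $z\in C^{k+2}(\overline{K}_{ij}\cup\overline{K}_{i+1,j})$, then for all $v\in\mathcal V_N$ $$\left|\int_{J_j}\{\!\{z-\Pi z\}\!\}_{i,y}\,[\![v]\!]_{i,y}\,dy\right|\le C\left[h_i^{\hat k}\|\partial_x^{\hat k+1}z\|_{K_{ij}\cup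 K_{i+1,j}}+h_i^{k+1}\|\partial_x^{k+2}z\|_{K_{ij}\cup K_{i+1,j}}\right]\|v\|_{K_{ij}\cup K_{i+1,j}}.$$ 2. If $1\le i\le N$, $1\le j\le N-1$, $h_j=h_{j+1}$ and $z\in C^{k+2}(\overline{K}_{ij}\cup\overline{K}_{i,j+1})$, then for all $v\in\mathcal V_N$ $$\left|\int_{I_i}\{\!\{z-\Pi z\}\!\}_{x,j}\,[\![v]\!]_{x,j}\,dx\right|\le C\left[h_j^{\hat k}\|\partial_y^{\hat k+1}z\|_{K_{ij}\cup K_{i,j+1}}+h_j^{k+1}\|\partial_y^{k+2}z\|_{K_{ij}\cup K_{i,j+1}}\right]\|v\|_{K_{ij}\cup K_{i,j+1}}.$$ -/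

import Mathlib

open MeasureTheory Filter Topology Set

noncomputable section

namespace LDG

/-- The exponent `k̂`: `k + 1` for even `k`, and `k` for odd `k`. -/
def kHat (k : ℕ) : ℕ := if Even k then k + 1 else k

/-! ### The Shishkin mesh -/

/-- The mesh transition parameter `τ = min {σ √ε ln N / β, 1/4}`. -/
def tau (ε σ β : ℝ) (N : ℕ) : ℝ := min (σ * √ε / β * Real.log N) (1 / 4)

/-- The mesh points `x_i = y_i`, `i = 0, …, N`, of the Shishkin mesh (`N` divisible by `4`); the
case distinctions are `i ≤ N/4`, `N/4 < i ≤ 3N/4` and `3N/4 < i`. -/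
def meshPt (ε σ β : ℝ) (N i : ℕ) : ℝ :=
  if 4 * i ≤ N then 4 * tau ε σ β N * i / N
  else if 4 * i ≤ 3 * N then
    tau ε σ β N + 2 * (1 - 2 * tau ε σ β N) * ((i : ℝ) / N - 1 / 4)
  else 1 - 4 * tau ε σ β N * (1 - (i : ℝ) / N)

/-- The width `h_i = x_i - x_{i-1}` (used for `i ≥ 1`). -/
def width (x : ℕ → ℝ) (i : ℕ) : ℝ := x i - x (i - 1)

/-- The open interval `(x_{i-1}, x_i)` (used for `i ≥ 1`). -/
def cell (x : ℕ → ℝ) (i : ℕ) : Set ℝ := Ioo (x (i - 1)) (x i)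

/-- The open mesh rectangle `K_{ij} = (x_{i-1}, x_i) × (y_{j-1}, y_j)`, where `y_j = x_j`. -/
def elt (x : ℕ → ℝ) (i j : ℕ) : Set (ℝ × ℝ) := cell x i ×ˢ cell x j

/-! ### Discrete functions -/

/-- Polynomial functions in two variables of degree at most `k` in each variable, i.e.
`𝒫^k ⊗ 𝒫^k`. -/
def Qk (k : ℕ) : Submodule ℝ (ℝ × ℝ → ℝ) :=
  Submodule.span ℝ (range fun (mn : Fin (k + 1) × Fin (k + 1)) (p : ℝ × ℝ) =>
    p.1 ^ (mn.1 : ℕ) * p.2 ^ (mn.2 : ℕ))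

/-- The finite element space `𝒱_N`: square-integrable functions on `Ω = (0,1)²` that agree on
each mesh rectangle with a function in `𝒬^k`. -/
def FESpace (k : ℕ) (x : ℕ → ℝ) (N : ℕ) : Set (ℝ × ℝ → ℝ) :=
  {v | MemLp v 2 (volume.restrict (Ioo (0 : ℝ) 1 ×ˢ Ioo (0 : ℝ) 1)) ∧
    ∀ i ∈ Finset.Icc 1 N, ∀ j ∈ Finset.Icc 1 N, ∃ q ∈ Qk k, EqOn v q (elt x i j)}

/-! ### Traces, jumps, averages (at interior mesh lines), and norms -/

/-- `v^+_{i,y}(y) = lim_{x → x_i^+} v(x, y)`, with `a = x_i`. -/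
def traceXPlus (v : ℝ × ℝ → ℝ) (a y : ℝ) : ℝ := limUnder (𝓝[>] a) fun s => v (s, y)

/-- `v^-_{i,y}(y) = lim_{x → x_i^-} v(x, y)`, with `a = x_i`. -/
def traceXMinus (v : ℝ × ℝ → ℝ) (a y : ℝ) : ℝ := limUnder (𝓝[<] a) fun s => v (s, y)

/-- `v^+_{x,j}(x) = lim_{y → y_j^+} v(x, y)`, with `b = y_j`. -/
def traceYPlus (v : ℝ × ℝ → ℝ) (b s : ℝ) : ℝ := limUnder (𝓝[>] b) fun y => v (s, y)

/-- `v^-_{x,j}(x) = lim_{y → y_j^-} v(x, y)`, with `b = y_j`. -/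
def traceYMinus (v : ℝ × ℝ → ℝ) (b s : ℝ) : ℝ := limUnder (𝓝[<] b) fun y => v (s, y)

/-- The jump across the vertical line with abscissa `a`. -/
def jumpX (v : ℝ × ℝ → ℝ) (a y : ℝ) : ℝ := traceXPlus v a y - traceXMinus v a y

/-- The average across the vertical line with abscissa `a`. -/
def avgX (v : ℝ × ℝ → ℝ) (a y : ℝ) : ℝ := (traceXPlus v a y + traceXMinus v a y) / 2

/-- The jump across the horizontal line with ordinate `b`. -/
def jumpY (v : ℝ × ℝ → ℝ) (b s : ℝ) : ℝ := traceYPlus v b s - traceYMinus v b s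

/-- The average across the horizontal line with ordinate `b`. -/
def avgY (v : ℝ × ℝ → ℝ) (b s : ℝ) : ℝ := (traceYPlus v b s + traceYMinus v b s) / 2

/-- `∂_x^m z`. -/
def dX (m : ℕ) (z : ℝ × ℝ → ℝ) (p : ℝ × ℝ) : ℝ := iteratedDeriv m (fun s => z (s, p.2)) p.1

/-- `∂_y^m z`. -/
def dY (m : ℕ) (z : ℝ × ℝ → ℝ) (p : ℝ × ℝ) : ℝ := iteratedDeriv m (fun t => z (p.1, t)) p.2

/-- The `L²(D)` norm. -/
def normL2 (D : Set (ℝ × ℝ)) (f : ℝ × ℝ → ℝ) : ℝ := √(∫ p in D, f p ^ 2)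

/-! ### The `L²` projector -/

/-- `q ∈ 𝒬^k` satisfies `⟨q, w⟩_K = ⟨z, w⟩_K` for all `w ∈ 𝒬^k`. -/
def IsL2Proj (k : ℕ) (K : Set (ℝ × ℝ)) (z q : ℝ × ℝ → ℝ) : Prop :=
  q ∈ Qk k ∧ ∀ w ∈ Qk k, ∫ p in K, q p * w p = ∫ p in K, z p * w p

open Classical in
/-- The `L²` projection of `z` on one element `K`; by `existsUnique_isL2Proj` it is well defined
for every `z ∈ L²(K)`, and the value `0` is a placeholder for other `z`. -/
def localProj (k : ℕ) (K : Set (ℝ × ℝ)) (z : ℝ × ℝ → ℝ) : ℝ × ℝ → ℝ :=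
  if h : ∃ q, IsL2Proj k K z q then h.choose else 0

/-- The piecewise projection `Πz`: on each mesh rectangle `K_{ij}` it is the `L²(K_{ij})`
projection of `z` (and `0` off the open mesh rectangles). -/
def piProj (k : ℕ) (x : ℕ → ℝ) (N : ℕ) (z : ℝ × ℝ → ℝ) (p : ℝ × ℝ) : ℝ :=
  ∑ i ∈ Finset.Icc 1 N, ∑ j ∈ Finset.Icc 1 N,
    (elt x i j).indicator (localProj k (elt x i j) z) p

instance (k : ℕ) : FiniteDimensional ℝ (Qk k) :=
  FiniteDimensional.span_of_finite ℝ (finite_range _)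

theorem analytic_of_mem_Qk {k : ℕ} {q : ℝ × ℝ → ℝ} (hq : q ∈ Qk k) :
    AnalyticOnNhd ℝ q univ := by
  induction hq using Submodule.span_induction with
  | mem f hf =>
    obtain ⟨mn, rfl⟩ := hf
    exact (analyticOnNhd_fst.pow _).mul (analyticOnNhd_snd.pow _)
  | zero => exact analyticOnNhd_const
  | add f g _ _ hf hg => exact hf.add hg
  | smul c f _ hf => exact (analyticOnNhd_const (v := c)).mul hf

theorem continuous_of_mem_Qk {k : ℕ} {q : ℝ × ℝ → ℝ} (hq : q ∈ Qk k) : Continuous q :=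
  continuousOn_univ.mp (analytic_of_mem_Qk hq).continuousOn

theorem memLp_of_mem_Qk {k : ℕ} {q : ℝ × ℝ → ℝ} (hq : q ∈ Qk k) (a b c d : ℝ) :
    MemLp q 2 (volume.restrict (Ioo a b ×ˢ Ioo c d)) := by
  have hc := continuous_of_mem_Qk hq
  have hK : IsCompact (Icc a b ×ˢ Icc c d) := isCompact_Icc.prod isCompact_Icc
  have : IsFiniteMeasure (volume.restrict (Icc a b ×ˢ Icc c d)) :=
    ⟨by simpa using hK.measure_lt_top⟩
  obtain ⟨M, hM⟩ := hK.exists_bound_of_continuousOn hc.continuousOn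
  have h : MemLp q 2 (volume.restrict (Icc a b ×ˢ Icc c d)) :=
    MemLp.of_bound hc.aestronglyMeasurable M
      ((ae_restrict_iff' hK.measurableSet).mpr (ae_of_all _ hM))
  exact h.mono_measure (Measure.restrict_mono (Set.prod_mono Ioo_subset_Icc_self Ioo_subset_Icc_self)
    le_rfl)

/-- The `L²` projection on a rectangle exists and is unique. -/
theorem existsUnique_isL2Proj (k : ℕ) {a b c d : ℝ} (hab : a < b) (hcd : c < d)
    {z : ℝ × ℝ → ℝ} (hz : MemLp z 2 (volume.restrict (Ioo a b ×ˢ Ioo c d))) :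
    ∃! q, IsL2Proj k (Ioo a b ×ˢ Ioo c d) z q := by
  set K := Ioo a b ×ˢ Ioo c d with hK
  have hint : ∀ f : ℝ × ℝ → ℝ, MemLp f 2 (volume.restrict K) → ∀ w ∈ Qk k,
      Integrable (fun p => f p * w p) (volume.restrict K) := fun f hf w hw =>
    hf.integrable_mul (memLp_of_mem_Qk hw a b c d)
  have hq2 : ∀ q ∈ Qk k, MemLp q 2 (volume.restrict K) := fun q hq => memLp_of_mem_Qk hq a b c d
  let F : ∀ f : ℝ × ℝ → ℝ, MemLp f 2 (volume.restrict K) → Module.Dual ℝ (Qk k) := fun f hf =>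
    { toFun := fun w => ∫ p in K, f p * (w : ℝ × ℝ → ℝ) p
      map_add' := fun w w' => by
        simp only [Submodule.coe_add, Pi.add_apply, mul_add]
        exact integral_add (hint f hf _ w.2) (hint f hf _ w'.2)
      map_smul' := fun r w => by
        simp only [Submodule.coe_smul, Pi.smul_apply, smul_eq_mul, RingHom.id_apply]
        rw [← integral_const_mul]
        congr 1; ext p; ring }
  let B : Qk k →ₗ[ℝ] Module.Dual ℝ (Qk k) :=
    { toFun := fun q => F q (hq2 q q.2)
      map_add' := fun q q' => by
        ext w
        simp only [F, LinearMap.coe_mk, AddHom.coe_mk, LinearMap.add_apply, Submodule.coe_add,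
          Pi.add_apply, add_mul]
        exact integral_add (hint _ (hq2 _ q.2) _ w.2) (hint _ (hq2 _ q'.2) _ w.2)
      map_smul' := fun r q => by
        ext w
        simp only [F, LinearMap.coe_mk, AddHom.coe_mk, LinearMap.smul_apply, Submodule.coe_smul,
          Pi.smul_apply, smul_eq_mul, RingHom.id_apply]
        rw [← integral_const_mul]
        congr 1; ext p; ring }
  have hinj : Function.Injective B := by
    rw [injective_iff_map_eq_zero]
    intro q hq
    have h0 : ∫ p in K, (q : ℝ × ℝ → ℝ) p * (q : ℝ × ℝ → ℝ) p = 0 :=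
      LinearMap.congr_fun hq q
    have hopen : IsOpen K := isOpen_Ioo.prod isOpen_Ioo
    have hcont := continuous_of_mem_Qk q.2
    have h1 := (setIntegral_eq_zero_iff_of_nonneg_ae
      (ae_of_all _ fun p => mul_self_nonneg _) (hint _ (hq2 _ q.2) _ q.2)).mp h0
    have h2 : EqOn (fun p => (q : ℝ × ℝ → ℝ) p * (q : ℝ × ℝ → ℝ) p) 0 K :=
      Measure.eqOn_open_of_ae_eq h1 hopen (hcont.mul hcont).continuousOn continuousOn_const
    have hm : ((a + b) / 2, (c + d) / 2) ∈ K := by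
      refine ⟨⟨?_, ?_⟩, ⟨?_, ?_⟩⟩ <;> dsimp only <;> linarith
    have h3 : (q : ℝ × ℝ → ℝ) = 0 := by
      refine (analytic_of_mem_Qk q.2).eq_of_eventuallyEq (z₀ := ((a + b) / 2, (c + d) / 2))
        analyticOnNhd_const ?_
      filter_upwards [hopen.mem_nhds hm] with p hp
      exact mul_self_eq_zero.mp (h2 hp)
    exact Subtype.ext h3
  have hsurj : Function.Surjective B :=
    (LinearMap.injective_iff_surjective_of_finrank_eq_finrank
      Subspace.dual_finrank_eq.symm).mp hinj
  obtain ⟨q, hq⟩ := hsurj (F z hz)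
  refine ⟨q, ⟨q.2, fun w hw => LinearMap.congr_fun hq ⟨w, hw⟩⟩, ?_⟩
  rintro q' ⟨hq', h'⟩
  have : (⟨q', hq'⟩ : Qk k) = q := hinj <| by
    rw [hq]
    ext w
    exact h' w w.2
  exact congrArg Subtype.val this

end LDG

end

/-!
Let `x = a` be the line between two elements of equal width `h`, and let `w` be the jump of `v`
across it, a polynomial of degree at most `k` along the edge. On polynomials of degree at most `k`,
evaluation at `0` is represented in `L²(0, 1)` by a polynomial `L` of degree at most `k`
(`LDG.exists_isReproducing`). The product of the rescaled `L` and `w` is a test function in `𝒬^k`,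
so the integral of the trace of `Πz` against `w` is the integral of `∫₀¹ z(a ± ht, ·) L(t) dt`
against `w` (`LDG.integral_edge_proj`). No tensor product structure of the projection is needed.

The quantity to estimate is therefore the integral over the edge of `w` times the one-dimensional
functional `g ↦ g(a) - ½ ∫₀¹ (g(a + ht) + g(a - ht)) L(t) dt` applied to `g = z(·, y)`. It vanishes
on polynomials of degree `k`, and for even `k` also on those of degree `k + 1`, because the odd
monomial `(s - a)^(k+1)` cancels between the two sides
(`LDG.integral_symm_mul_reproducing`). This is where equal widths enter. A Taylor
expansion at `a` bounds the functional by `h ^ k̂` times the `L¹` norm of the derivative of order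
`k̂ + 1` (`LDG.abs_sub_integral_reproducing_le`). The Cauchy–Schwarz inequality on the pair of
elements and the discrete trace inequality for `w` (`LDG.edge_sq_add_le`), whose powers of `h`
cancel, give the first term of the claimed bound; the second term is nonnegative. Estimates across
horizontal lines follow by exchanging the coordinates.
-/

namespace LDG

open Polynomial

/-! ### Taylor expansion at the centre of an interval, with an `L¹` remainder -/

/-- The remainder of a Taylor polynomial is bounded by the `L¹` norm of the next derivative. The
derivatives are given as a sequence `f 0, f 1, …`, each the derivative of its predecessor within the
closed interval. -/
theorem exists_taylor_bound {a h : ℝ} (hh : 0 < h) (m : ℕ) (f : ℕ → ℝ → ℝ)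
    (hf : ∀ r ≤ m, ∀ s ∈ Icc (a - h) (a + h),
      HasDerivWithinAt (f r) (f (r + 1) s) (Icc (a - h) (a + h)) s)
    (hc : ContinuousOn (f (m + 1)) (Icc (a - h) (a + h))) :
    ∃ c : ℕ → ℝ, ∀ s ∈ Icc (a - h) (a + h),
      |f 0 s - ∑ r ∈ Finset.range (m + 1), c r * (s - a) ^ r| ≤
        h ^ m * ∫ t in Ioo (a - h) (a + h), |f (m + 1) t| := by
  have ha : a ∈ Icc (a - h) (a + h) := ⟨by linarith, by linarith⟩
  induction m generalizing f with
  | zero =>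
    refine ⟨fun _ => f 0 a, fun s hs => ?_⟩
    have hsub : uIcc a s ⊆ Icc (a - h) (a + h) := uIcc_subset_Icc ha hs
    have hint : IntervalIntegrable (f 1) volume a s := (hc.mono hsub).intervalIntegrable
    have key : ∫ t in a..s, f 1 t = f 0 s - f 0 a := by
      refine intervalIntegral.integral_eq_sub_of_hasDeriv_right
        (fun t ht => ((hf 0 le_rfl t (hsub ht)).continuousWithinAt).mono hsub) (fun t ht => ?_) hint
      have ht' : t ∈ Ioo (a - h) (a + h) := by
        constructor
        · rcases le_total a s with h1 | h1
          · rw [min_eq_left h1] at ht; linarith [ht.1]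
          · rw [min_eq_right h1] at ht; linarith [ht.1, hs.1]
        · rcases le_total a s with h1 | h1
          · rw [max_eq_right h1] at ht; linarith [ht.2, hs.2]
          · rw [max_eq_left h1] at ht; linarith [ht.2]
      exact ((hf 0 le_rfl t (Ioo_subset_Icc_self ht')).hasDerivAt
        (Icc_mem_nhds ht'.1 ht'.2)).hasDerivWithinAt
    simp only [zero_add, Finset.range_one, Finset.sum_singleton, pow_zero, mul_one, one_mul]
    rw [← key, ← integral_Icc_eq_integral_Ioo, ← Real.norm_eq_abs]
    refine intervalIntegral.norm_integral_le_integral_norm_uIoc.trans ?_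
    refine setIntegral_mono_set (hc.abs.integrableOn_Icc) (ae_of_all _ fun t => abs_nonneg _)
      (LE.le.eventuallyLE (uIoc_subset_uIcc.trans hsub))
  | succ m ih =>
    obtain ⟨c, hcb⟩ := ih (fun r => f (r + 1)) (fun r hr => hf (r + 1) (by omega)) hc
    set A := ∫ t in Ioo (a - h) (a + h), |f (m + 1 + 1) t| with hA
    have hA0 : 0 ≤ A := integral_nonneg fun t => abs_nonneg _
    refine ⟨fun r => if r = 0 then f 0 a else c (r - 1) / r, fun s hs => ?_⟩
    let P : ℝ → ℝ := fun s => ∑ r ∈ Finset.range (m + 1), c r / ((r : ℝ) + 1) * (s - a) ^ (r + 1)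
    have hP : ∀ s, HasDerivAt P (∑ r ∈ Finset.range (m + 1), c r * (s - a) ^ r) s := by
      intro s
      refine HasDerivAt.fun_sum fun r _ => ?_
      have := (((hasDerivAt_id s).sub_const a).pow (r + 1)).const_mul (c r / ((r : ℝ) + 1))
      refine this.congr_deriv ?_
      have : (r : ℝ) + 1 ≠ 0 := by positivity
      simp
      field_simp
    have hder : ∀ t ∈ Icc (a - h) (a + h), HasDerivWithinAt (fun t => f 0 t - P t)
        (f 1 t - ∑ r ∈ Finset.range (m + 1), c r * (t - a) ^ r) (Icc (a - h) (a + h)) t :=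
      fun t ht => (hf 0 (by omega) t ht).sub (hP t).hasDerivWithinAt
    have hmv := (convex_Icc (a - h) (a + h)).norm_image_sub_le_of_norm_hasDerivWithin_le hder
      (fun t ht => hcb t ht) ha hs
    have hPa : P a = 0 := by simp [P]
    have hsa : ‖s - a‖ ≤ h := by
      rw [Real.norm_eq_abs, abs_le]; constructor <;> linarith [hs.1, hs.2]
    rw [Finset.sum_range_succ']
    have e : f 0 s - (∑ r ∈ Finset.range (m + 1), (if r + 1 = 0 then f 0 a else
        c (r + 1 - 1) / ((r + 1 : ℕ) : ℝ)) * (s - a) ^ (r + 1) +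
        (if 0 = 0 then f 0 a else c (0 - 1) / ((0 : ℕ) : ℝ)) * (s - a) ^ 0) =
        f 0 s - P s - (f 0 a - P a) := by
      rw [hPa]; simp [P]; ring
    rw [e, ← Real.norm_eq_abs]
    calc _ ≤ h ^ m * A * ‖s - a‖ := hmv
      _ ≤ h ^ m * A * h := by gcongr
      _ = h ^ (m + 1) * A := by ring

/-! ### Partial derivatives on a closed rectangle -/

/-- The `r`-th derivative of `z` in the first coordinate direction, taken within `S`; unlike
`dX r z` it is meaningful up to the boundary of a closed rectangle `S`. -/
noncomputable def derivFst (S : Set (ℝ × ℝ)) (z : ℝ × ℝ → ℝ) : ℕ → ℝ × ℝ → ℝ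
  | 0 => z
  | r + 1 => fun p => fderivWithin ℝ (derivFst S z r) S p (1, 0)

theorem contDiffOn_derivFst {S : Set (ℝ × ℝ)} (hS : UniqueDiffOn ℝ S) {z : ℝ × ℝ → ℝ} {n : ℕ}
    (hz : ContDiffOn ℝ n z S) {r : ℕ} (hr : r ≤ n) :
    ContDiffOn ℝ (n - r : ℕ) (derivFst S z r) S := by
  induction r with
  | zero => simpa [derivFst] using hz
  | succ r ih =>
    have h1 := (ih (by omega)).fderivWithin hS (m := ((n - (r + 1) : ℕ) : WithTop ℕ∞))
      (by norm_cast; omega)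
    exact h1.clm_apply contDiffOn_const

theorem continuousOn_derivFst {S : Set (ℝ × ℝ)} (hS : UniqueDiffOn ℝ S) {z : ℝ × ℝ → ℝ} {n : ℕ}
    (hz : ContDiffOn ℝ n z S) {r : ℕ} (hr : r ≤ n) : ContinuousOn (derivFst S z r) S :=
  (contDiffOn_derivFst hS hz hr).continuousOn

theorem hasDerivWithinAt_derivFst {A B : Set ℝ} (hS : UniqueDiffOn ℝ (A ×ˢ B)) {z : ℝ × ℝ → ℝ}
    {n : ℕ} (hz : ContDiffOn ℝ n z (A ×ˢ B)) {r : ℕ} (hr : r < n) {s y : ℝ} (hs : s ∈ A)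
    (hy : y ∈ B) :
    HasDerivWithinAt (fun s => derivFst (A ×ˢ B) z r (s, y))
      (derivFst (A ×ˢ B) z (r + 1) (s, y)) A s := by
  have hd : DifferentiableWithinAt ℝ (derivFst (A ×ˢ B) z r) (A ×ˢ B) (s, y) :=
    (contDiffOn_derivFst hS hz hr.le).differentiableOn (by norm_cast; omega) _ ⟨hs, hy⟩
  have hl : HasDerivWithinAt (fun s : ℝ => (s, y)) ((1 : ℝ), (0 : ℝ)) A s :=
    ((hasDerivAt_id s).prodMk (hasDerivAt_const s y)).hasDerivWithinAt
  exact hd.hasFDerivWithinAt.comp_hasDerivWithinAt s hl fun t ht => Set.mk_mem_prod ht hy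

theorem dX_eq_derivFst {a b : ℝ} {B : Set ℝ} (hS : UniqueDiffOn ℝ (Icc a b ×ˢ B))
    {z : ℝ × ℝ → ℝ} {n : ℕ} (hz : ContDiffOn ℝ n z (Icc a b ×ˢ B)) {r : ℕ} (hr : r ≤ n)
    {s y : ℝ} (hs : s ∈ Ioo a b) (hy : y ∈ B) :
    dX r z (s, y) = derivFst (Icc a b ×ˢ B) z r (s, y) := by
  simp only [dX]
  induction r generalizing s with
  | zero => simp [derivFst]
  | succ r ih =>
    rw [iteratedDeriv_succ]
    have h1 := (hasDerivWithinAt_derivFst hS hz (r := r) (by omega) (Ioo_subset_Icc_self hs)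
      hy).hasDerivAt (Icc_mem_nhds hs.1 hs.2)
    rw [← h1.deriv]
    refine Filter.EventuallyEq.deriv_eq ?_
    filter_upwards [isOpen_Ioo.mem_nhds hs] with t ht using ih (by omega) ht


/-! ### The reproducing polynomial of the left end point of `[0, 1]` -/

/-- `IsReproducing k L` says that `L` has degree at most `k` and represents evaluation at `0` on
the polynomials of degree at most `k`, with respect to the inner product of `L²(0, 1)`. -/
def IsReproducing (k : ℕ) (L : ℝ[X]) : Prop :=
  L.natDegree ≤ k ∧
    ∀ q : ℝ[X], q.natDegree ≤ k → ∫ t in (0 : ℝ)..1, q.eval t * L.eval t = q.eval 0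

/-- The inner product of `L²(0, 1)` is nondegenerate on the finite-dimensional space of polynomials
of degree at most `k`, so it represents every linear functional on that space. -/
theorem exists_isReproducing (k : ℕ) : ∃ L, IsReproducing k L := by
  let V := degreeLT ℝ (k + 1)
  have hint : ∀ p q : ℝ[X], IntervalIntegrable (fun t => p.eval t * q.eval t) volume 0 1 :=
    fun p q => (p.continuous.mul q.continuous).intervalIntegrable _ _
  let B : V →ₗ[ℝ] Module.Dual ℝ V := LinearMap.mk₂ ℝ
    (fun p q : V => ∫ t in (0 : ℝ)..1, (p : ℝ[X]).eval t * (q : ℝ[X]).eval t)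
    (fun p p' q => by
      simp only [Submodule.coe_add, eval_add, add_mul]
      exact intervalIntegral.integral_add (hint _ _) (hint _ _))
    (fun r p q => by
      simp only [Submodule.coe_smul, eval_smul, smul_eq_mul, mul_assoc]
      exact intervalIntegral.integral_const_mul _ _)
    (fun p q q' => by
      simp only [Submodule.coe_add, eval_add, mul_add]
      exact intervalIntegral.integral_add (hint _ _) (hint _ _))
    (fun r p q => by
      simp only [Submodule.coe_smul, eval_smul, smul_eq_mul, mul_left_comm _ r]
      exact intervalIntegral.integral_const_mul _ _)
  have : FiniteDimensional ℝ V := (degreeLTEquiv ℝ (k + 1)).symm.finiteDimensional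
  have hinj : Function.Injective B := by
    rw [injective_iff_map_eq_zero]
    intro p hp
    have h0 : ∫ t in (0 : ℝ)..1, (p : ℝ[X]).eval t * (p : ℝ[X]).eval t = 0 :=
      LinearMap.congr_fun hp p
    have h1 : ∀ t ∈ Icc (0 : ℝ) 1, (p : ℝ[X]).eval t = 0 := by
      by_contra! hne
      obtain ⟨t, ht, hne⟩ := hne
      have := intervalIntegral.integral_pos (f := fun t => (p : ℝ[X]).eval t * (p : ℝ[X]).eval t)
        zero_lt_one ((p : ℝ[X]).continuous.mul (p : ℝ[X]).continuous).continuousOn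
        (fun t _ => mul_self_nonneg _) ⟨t, ht, mul_self_pos.2 hne⟩
      exact this.ne' h0
    exact Subtype.ext (eq_zero_of_infinite_isRoot _
      ((Icc_infinite zero_lt_one).mono fun t ht => h1 t ht))
  have hsurj : Function.Surjective B :=
    (LinearMap.injective_iff_surjective_of_finrank_eq_finrank
      Subspace.dual_finrank_eq.symm).mp hinj
  have hmem : ∀ q : ℝ[X], q ∈ V ↔ q.natDegree ≤ k := fun q => by
    rw [mem_degreeLT, degree_lt_iff_coeff_zero, natDegree_le_iff_coeff_eq_zero]
    exact Iff.rfl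
  obtain ⟨L, hL⟩ := hsurj ((leval (0 : ℝ)).comp V.subtype)
  refine ⟨L, (hmem _).1 L.2, fun q hq => ?_⟩
  have := LinearMap.congr_fun hL ⟨q, (hmem q).2 hq⟩
  simp only [mul_comm (q.eval _)]
  exact this

theorem exists_bound_eval (L : ℝ[X]) : ∃ M : ℝ, 0 < M ∧ ∀ t ∈ Icc (0 : ℝ) 1, |L.eval t| ≤ M := by
  obtain ⟨M, hM⟩ := (isCompact_Icc (a := (0 : ℝ)) (b := 1)).exists_bound_of_continuousOn
    L.continuous.continuousOn
  exact ⟨max M 1, by positivity, fun t ht => (hM t ht).trans (le_max_left _ _)⟩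

/-! ### The one-dimensional error functional -/

/-- The average of the two one-sided reconstructions of `p(a)` is exact for polynomials of degree
`k̂`. For even `k` the top degree `k + 1` is odd, and it is the symmetry of the two intervals,
which have equal width, that makes its contribution cancel. -/
theorem integral_symm_mul_reproducing {k : ℕ} {L : ℝ[X]} (hL : IsReproducing k L) (a h : ℝ)
    (c : ℕ → ℝ) :
    ∫ t in (0 : ℝ)..1, ((∑ r ∈ Finset.range (kHat k + 1), c r * (a + h * t - a) ^ r) +
        (∑ r ∈ Finset.range (kHat k + 1), c r * (a + -h * t - a) ^ r)) * L.eval t =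
      2 * c 0 := by
  have hmono : ∀ r ∈ Finset.range (kHat k + 1),
      ∫ t in (0 : ℝ)..1, (c r * (h ^ r + (-h) ^ r)) * (t ^ r * L.eval t) =
        (c r * (h ^ r + (-h) ^ r)) * if r = 0 then 1 else 0 := by
    intro r hr
    rw [intervalIntegral.integral_const_mul]
    by_cases hrk : r ≤ k
    · have := hL.2 (X ^ r) (by simpa using hrk)
      simp only [eval_pow, eval_X] at this
      rw [this, zero_pow_eq]
    · have hr' := Finset.mem_range.1 hr
      unfold kHat at hr'
      split_ifs at hr' with hk
      · obtain rfl : r = k + 1 := by omega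
        rw [hk.add_one.neg_pow]; simp
      · omega
  calc _ = ∫ t in (0 : ℝ)..1, ∑ r ∈ Finset.range (kHat k + 1),
        (c r * (h ^ r + (-h) ^ r)) * (t ^ r * L.eval t) := by
        congr 1; ext t
        rw [← Finset.sum_add_distrib, Finset.sum_mul]
        refine Finset.sum_congr rfl fun r _ => ?_
        rw [add_sub_cancel_left, add_sub_cancel_left, mul_pow, mul_pow]; ring
    _ = ∑ r ∈ Finset.range (kHat k + 1), (c r * (h ^ r + (-h) ^ r)) * if r = 0 then 1 else 0 := by
        rw [intervalIntegral.integral_finsetSum fun r _ =>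
          (Continuous.intervalIntegrable (by fun_prop) _ _)]
        exact Finset.sum_congr rfl hmono
    _ = 2 * c 0 := by
        rw [Finset.sum_eq_single 0 (fun r _ hr => by simp [hr]) (by simp)]
        simp; ring

/-- Bramble–Hilbert estimate for the error functional
`g ↦ g(a) - ½ ∫₀¹ (g(a + ht) + g(a - ht)) L(t) dt`. -/
theorem abs_sub_integral_reproducing_le {k : ℕ} {L : ℝ[X]} (hL : IsReproducing k L) {M : ℝ}
    (hM : ∀ t ∈ Icc (0 : ℝ) 1, |L.eval t| ≤ M) {a h : ℝ} (hh : 0 < h) (f : ℕ → ℝ → ℝ)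
    (hf : ∀ r ≤ kHat k, ∀ s ∈ Icc (a - h) (a + h),
      HasDerivWithinAt (f r) (f (r + 1) s) (Icc (a - h) (a + h)) s)
    (hc : ContinuousOn (f (kHat k + 1)) (Icc (a - h) (a + h))) :
    |f 0 a - ((∫ t in (0 : ℝ)..1, f 0 (a + h * t) * L.eval t) +
        ∫ t in (0 : ℝ)..1, f 0 (a + -h * t) * L.eval t) / 2| ≤
      (1 + M) * h ^ kHat k * ∫ t in Ioo (a - h) (a + h), |f (kHat k + 1) t| := by
  obtain ⟨c, hcb⟩ := exists_taylor_bound hh (kHat k) f hf hc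
  set A := ∫ t in Ioo (a - h) (a + h), |f (kHat k + 1) t| with hA
  let P : ℝ → ℝ := fun s => ∑ r ∈ Finset.range (kHat k + 1), c r * (s - a) ^ r
  have hPc : Continuous P := by fun_prop
  have hPa : P a = c 0 := by
    simp only [P, sub_self]
    rw [Finset.sum_eq_single 0 (fun r _ hr => by simp [hr]) (by simp)]; simp
  have hf0 : ContinuousOn (f 0) (Icc (a - h) (a + h)) := fun s hs =>
    (hf 0 (Nat.zero_le _) s hs).continuousWithinAt
  have ha : a ∈ Icc (a - h) (a + h) := ⟨by linarith, by linarith⟩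
  -- both one-sided reconstructions, for `u = h` and for `u = -h`
  have hside : ∀ u : ℝ, |u| ≤ h →
      IntervalIntegrable (fun t => P (a + u * t) * L.eval t) volume 0 1 ∧
      |(∫ t in (0 : ℝ)..1, f 0 (a + u * t) * L.eval t) -
        ∫ t in (0 : ℝ)..1, P (a + u * t) * L.eval t| ≤ h ^ kHat k * A * M := by
    intro u hu
    have hmem : ∀ t ∈ Icc (0 : ℝ) 1, a + u * t ∈ Icc (a - h) (a + h) := fun t ht => by
      have h1 := (abs_le.1 hu).1
      have h2 := (abs_le.1 hu).2
      constructor <;> nlinarith [ht.1, ht.2]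
    have hi : IntervalIntegrable (fun t => P (a + u * t) * L.eval t) volume 0 1 :=
      Continuous.intervalIntegrable (by fun_prop) _ _
    have hi' : IntervalIntegrable (fun t => f 0 (a + u * t) * L.eval t) volume 0 1 := by
      refine ContinuousOn.intervalIntegrable ?_
      rw [uIcc_of_le zero_le_one]
      exact (hf0.comp (by fun_prop) hmem).mul L.continuous.continuousOn
    refine ⟨hi, ?_⟩
    rw [← intervalIntegral.integral_sub hi' hi, ← Real.norm_eq_abs]
    refine (intervalIntegral.norm_integral_le_of_norm_le_const
      (C := h ^ kHat k * A * M) fun t ht => ?_).trans (by simp)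
    rw [uIoc_of_le zero_le_one] at ht
    have ht' := Ioc_subset_Icc_self ht
    have hb := hcb _ (hmem t ht')
    rw [← sub_mul, norm_mul]
    exact mul_le_mul hb (hM t ht') (norm_nonneg _) ((abs_nonneg _).trans hb)
  obtain ⟨hi1, h1⟩ := hside h (abs_of_pos hh).le
  obtain ⟨hi2, h2⟩ := hside (-h) (by rw [abs_neg, abs_of_pos hh])
  have h3 : (∫ t in (0 : ℝ)..1, P (a + h * t) * L.eval t) +
      (∫ t in (0 : ℝ)..1, P (a + -h * t) * L.eval t) = 2 * P a := by
    rw [← intervalIntegral.integral_add hi1 hi2, hPa, ← integral_symm_mul_reproducing hL a h c]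
    exact intervalIntegral.integral_congr fun t _ => (add_mul _ _ _).symm
  have h0 := hcb a ha
  change |f 0 a - P a| ≤ _ at h0
  rw [show (1 + M) * h ^ kHat k * A = h ^ kHat k * A + h ^ kHat k * A * M by ring]
  rw [abs_le] at h0 h1 h2 ⊢
  constructor <;> linarith [h0.1, h0.2, h1.1, h1.2, h2.1, h2.2]


/-! ### Traces of functions in `𝒬^k` -/

theorem exists_polynomial_of_mem_Qk {k : ℕ} {q : ℝ × ℝ → ℝ} (hq : q ∈ Qk k) (a u y : ℝ) :
    ∃ P : ℝ[X], P.natDegree ≤ k ∧ ∀ t, P.eval t = q (a + u * t, y) := by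
  induction hq using Submodule.span_induction with
  | mem f hf =>
    obtain ⟨mn, rfl⟩ := hf
    refine ⟨(C a + C u * X) ^ (mn.1 : ℕ) * C (y ^ (mn.2 : ℕ)), ?_, fun t => by simp⟩
    refine (natDegree_mul_C_le _ _).trans ((natDegree_pow_le_of_le (m := 1) _ ?_).trans ?_)
    · compute_degree
    · have := mn.1.2; omega
  | zero => exact ⟨0, by simp, fun t => by simp⟩
  | add f g _ _ hf hg =>
    obtain ⟨P, hP, hP'⟩ := hf
    obtain ⟨R, hR, hR'⟩ := hg
    exact ⟨P + R, natDegree_add_le_of_degree_le hP hR, fun t => by simp [hP', hR']⟩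
  | smul c f _ hf =>
    obtain ⟨P, hP, hP'⟩ := hf
    exact ⟨c • P, (natDegree_smul_le _ _).trans hP, fun t => by simp [hP']⟩

/-- A function in `𝒬^k` is recovered on the line `x = a` from its values on either side. -/
theorem integral_reproducing_of_mem_Qk {k : ℕ} {L : ℝ[X]} (hL : IsReproducing k L)
    {q : ℝ × ℝ → ℝ} (hq : q ∈ Qk k) (a u y : ℝ) :
    ∫ t in (0 : ℝ)..1, q (a + u * t, y) * L.eval t = q (a, y) := by
  obtain ⟨P, hP, hP'⟩ := exists_polynomial_of_mem_Qk hq a u y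
  simp_rw [← hP', hL.2 P hP, hP', mul_zero, add_zero]

theorem eval_mul_trace_mem_Qk {k : ℕ} {P : ℝ[X]} (hP : P.natDegree ≤ k) {q : ℝ × ℝ → ℝ}
    (hq : q ∈ Qk k) (a : ℝ) : (fun p : ℝ × ℝ => P.eval p.1 * q (a, p.2)) ∈ Qk k := by
  induction hq using Submodule.span_induction with
  | mem f hf =>
    obtain ⟨mn, rfl⟩ := hf
    have e : (fun p : ℝ × ℝ => P.eval p.1 * (a ^ (mn.1 : ℕ) * p.2 ^ (mn.2 : ℕ))) =
        ∑ i : Fin (k + 1), (P.coeff i * a ^ (mn.1 : ℕ)) •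
          fun p : ℝ × ℝ => p.1 ^ (i : ℕ) * p.2 ^ (mn.2 : ℕ) := by
      ext p
      rw [eval_eq_sum_range' (Nat.lt_succ_of_le hP), ← Fin.sum_univ_eq_sum_range
        (fun i => P.coeff i * p.1 ^ i), Finset.sum_mul, Finset.sum_apply]
      refine Finset.sum_congr rfl fun i _ => ?_
      simp only [Pi.smul_apply, smul_eq_mul]; ring
    rw [e]
    exact Submodule.sum_mem _ fun i _ =>
      Submodule.smul_mem _ _ (Submodule.subset_span ⟨(i, mn.2), rfl⟩)
  | zero => simp only [Pi.zero_apply, mul_zero]; exact (Qk k).zero_mem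
  | add f g _ _ hf hg =>
    convert (Qk k).add_mem hf hg using 1
    ext p; simp [mul_add]
  | smul c f _ hf =>
    convert (Qk k).smul_mem c hf using 1
    ext p; simp; ring

/-! ### The projection tested on an element edge -/

/-- `I` is an interval of length `|u|` with `a` as one of its end points, on the side given by the
sign of `u`. -/
def IsSideOf (I : Set ℝ) (a u : ℝ) : Prop :=
  (0 < u ∧ I = Ioo a (a + u)) ∨ (u < 0 ∧ I = Ioo (a + u) a)

theorem IsSideOf.ne_zero {I : Set ℝ} {a u : ℝ} (hI : IsSideOf I a u) : u ≠ 0 := by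
  rcases hI with ⟨h, _⟩ | ⟨h, _⟩
  · exact h.ne'
  · exact h.ne

theorem IsSideOf.setIntegral {I : Set ℝ} {a u : ℝ} (hI : IsSideOf I a u) (F : ℝ → ℝ) :
    ∫ s in I, F s = |u| * ∫ t in (0 : ℝ)..1, F (a + u * t) := by
  have h := intervalIntegral.smul_integral_comp_add_mul (a := 0) (b := 1) F u a
  simp only [mul_zero, add_zero, mul_one, smul_eq_mul] at h
  rcases hI with ⟨hu, rfl⟩ | ⟨hu, rfl⟩
  · rw [abs_of_pos hu, h, intervalIntegral.integral_of_le (by linarith),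
      integral_Ioc_eq_integral_Ioo]
  · rw [abs_of_neg hu, neg_mul, h, intervalIntegral.integral_of_ge (by linarith),
      integral_Ioc_eq_integral_Ioo, neg_neg]

theorem IsSideOf.subset_Icc {I : Set ℝ} {a u : ℝ} (hI : IsSideOf I a u) :
    I ⊆ Icc (a - |u|) (a + |u|) := by
  rcases hI with ⟨hu, rfl⟩ | ⟨hu, rfl⟩
  · rw [abs_of_pos hu]
    exact fun s hs => ⟨by linarith [hs.1], hs.2.le⟩
  · rw [abs_of_neg hu]
    exact fun s hs => ⟨by linarith [hs.1], by linarith [hs.2]⟩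

theorem IsSideOf.measurableSet {I : Set ℝ} {a u : ℝ} (hI : IsSideOf I a u) :
    MeasurableSet I := by
  rcases hI with ⟨_, rfl⟩ | ⟨_, rfl⟩ <;> exact measurableSet_Ioo

theorem integrableOn_prod_of_continuousOn {I J : Set ℝ} {a b c d : ℝ} (hI : I ⊆ Icc a b)
    (hJ : J ⊆ Icc c d) {f : ℝ × ℝ → ℝ} (hf : ContinuousOn f (Icc a b ×ˢ Icc c d)) :
    Integrable f ((volume.restrict I).prod (volume.restrict J)) := by
  rw [Measure.prod_restrict]
  exact (hf.integrableOn_compact (isCompact_Icc.prod isCompact_Icc)).mono_set (Set.prod_mono hI hJ)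

/-- Testing the projection on the edge `{a} × J` of `I × J` against a trace of a function in `𝒬^k`
amounts to testing the one-sided reconstruction of `z`, since the product of the (rescaled)
reproducing polynomial and the trace is again in `𝒬^k`. -/
theorem integral_edge_proj {k : ℕ} {L : ℝ[X]} (hL : IsReproducing k L) {I J : Set ℝ} {a u c d : ℝ}
    (hI : IsSideOf I a u) (hJ : J ⊆ Icc c d) {z q p : ℝ × ℝ → ℝ}
    (hz : ContinuousOn z (Icc (a - |u|) (a + |u|) ×ˢ Icc c d))
    (hq : IsL2Proj k (I ×ˢ J) z q) (hp : p ∈ Qk k) :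
    IntegrableOn (fun y => (∫ t in (0 : ℝ)..1, z (a + u * t, y) * L.eval t) * p (a, y)) J ∧
      ∫ y in J, q (a, y) * p (a, y) =
        ∫ y in J, (∫ t in (0 : ℝ)..1, z (a + u * t, y) * L.eval t) * p (a, y) := by
  have hu := hI.ne_zero
  set R : ℝ[X] := L.comp (C u⁻¹ * X + C (-(u⁻¹ * a))) with hR
  have hRe : ∀ t, R.eval (a + u * t) = L.eval t := by
    intro t
    rw [hR, eval_comp]
    congr 1
    simp; field_simp; ring
  have hRd : R.natDegree ≤ k := by
    refine natDegree_comp_le.trans ?_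
    calc _ ≤ k * 1 := Nat.mul_le_mul hL.1 natDegree_linear_le
      _ = k := mul_one k
  have hW := eval_mul_trace_mem_Qk hRd hp a
  have hpc := continuous_of_mem_Qk hp
  have hfub : ∀ f : ℝ × ℝ → ℝ, ContinuousOn f (Icc (a - |u|) (a + |u|) ×ˢ Icc c d) →
      Integrable (fun y => |u| * ((∫ t in (0 : ℝ)..1, f (a + u * t, y) * L.eval t) * p (a, y)))
        (volume.restrict J) ∧
      ∫ x in I ×ˢ J, f x * (R.eval x.1 * p (a, x.2)) =
        ∫ y in J, |u| * ((∫ t in (0 : ℝ)..1, f (a + u * t, y) * L.eval t) * p (a, y)) := by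
    intro f hf
    have hint := integrableOn_prod_of_continuousOn hI.subset_Icc hJ
      (f := fun x => f x * (R.eval x.1 * p (a, x.2)))
      (hf.mul (Continuous.continuousOn (by fun_prop)))
    have he : ∀ y, ∫ s in I, f (s, y) * (R.eval s * p (a, y)) =
        |u| * ((∫ t in (0 : ℝ)..1, f (a + u * t, y) * L.eval t) * p (a, y)) := by
      intro y
      rw [hI.setIntegral, ← intervalIntegral.integral_mul_const]
      simp only [hRe, mul_assoc]
    refine ⟨?_, ?_⟩
    · exact hint.integral_prod_right.congr (ae_of_all _ he)
    · rw [Measure.volume_eq_prod, ← Measure.prod_restrict, integral_prod_symm _ hint]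
      exact integral_congr_ae (ae_of_all _ he)
  obtain ⟨hzi, hz2⟩ := hfub z hz
  obtain ⟨-, hq2⟩ := hfub q (continuous_of_mem_Qk hq.1).continuousOn
  have hu' : |u| ≠ 0 := abs_ne_zero.2 hu
  refine ⟨?_, ?_⟩
  · have := hzi.const_mul |u|⁻¹
    refine this.congr (ae_of_all _ fun y => ?_)
    simp only []
    rw [inv_mul_cancel_left₀ hu']
  · have h := hq.2 _ hW
    rw [hz2, hq2, integral_const_mul, integral_const_mul] at h
    simp_rw [integral_reproducing_of_mem_Qk hL hq.1] at h
    exact mul_left_cancel₀ hu' h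

/-! ### Cauchy–Schwarz and the trace inequality -/

theorem integral_abs_mul_abs_le {α : Type*} [MeasurableSpace α] {μ : Measure α} {f g : α → ℝ}
    (hf : MemLp f 2 μ) (hg : MemLp g 2 μ) :
    ∫ x, |f x| * |g x| ∂μ ≤ √(∫ x, f x ^ 2 ∂μ) * √(∫ x, g x ^ 2 ∂μ) := by
  have h := integral_mul_norm_le_Lp_mul_Lq (μ := μ) (f := f) (g := g) (p := 2) (q := 2)
    Real.HolderConjugate.two_two (by simpa using hf) (by simpa using hg)
  simpa [Real.sqrt_eq_rpow] using h

/-- Discrete trace inequality: for `q ∈ 𝒬^k`, the `L²` norm on the edge `{a} × J` of `I × J` is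
controlled by the `L²(I × J)` norm, scaled by the inverse root of the width `|u|` of `I`. -/
theorem integral_edge_sq_le {k : ℕ} {L : ℝ[X]} (hL : IsReproducing k L) {M : ℝ}
    (hM : ∀ t ∈ Icc (0 : ℝ) 1, |L.eval t| ≤ M) {I J : Set ℝ} {a u c d : ℝ}
    (hI : IsSideOf I a u) (hJ : J ⊆ Icc c d) {q : ℝ × ℝ → ℝ}
    (hq : q ∈ Qk k) :
    |u| * ∫ y in J, q (a, y) ^ 2 ≤ M ^ 2 * ∫ x in I ×ˢ J, q x ^ 2 := by
  have hqc := continuous_of_mem_Qk hq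
  have hpt : ∀ y, q (a, y) ^ 2 ≤ M ^ 2 * ∫ t in (0 : ℝ)..1, q (a + u * t, y) ^ 2 := by
    intro y
    have : IsFiniteMeasure (volume.restrict (Ioc (0 : ℝ) 1)) := ⟨by simp⟩
    have hLp : ∀ f : ℝ → ℝ, Continuous f → MemLp f 2 (volume.restrict (Ioc (0 : ℝ) 1)) := by
      intro f hf
      obtain ⟨B, hB⟩ := (isCompact_Icc (a := (0 : ℝ)) (b := 1)).exists_bound_of_continuousOn
        hf.continuousOn
      exact MemLp.of_bound hf.aestronglyMeasurable B ((ae_restrict_iff' measurableSet_Ioc).2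
        (ae_of_all _ fun t ht => hB t (Ioc_subset_Icc_self ht)))
    have hcs := integral_abs_mul_abs_le (hLp (fun t => q (a + u * t, y)) (by fun_prop))
      (hLp _ L.continuous)
    have hLM : ∫ t in Ioc (0 : ℝ) 1, L.eval t ^ 2 ≤ M ^ 2 := by
      calc _ ≤ ∫ t in Ioc (0 : ℝ) 1, M ^ 2 := by
            refine setIntegral_mono_on (hLp _ L.continuous).integrable_sq
              (integrable_const _) measurableSet_Ioc fun t ht => ?_
            exact sq_le_sq' (abs_le.1 (hM t (Ioc_subset_Icc_self ht))).1
              (abs_le.1 (hM t (Ioc_subset_Icc_self ht))).2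
        _ = M ^ 2 := by simp
    rw [intervalIntegral.integral_of_le zero_le_one]
    set X := ∫ t in Ioc (0 : ℝ) 1, q (a + u * t, y) ^ 2 with hX
    have hX0 : 0 ≤ X := integral_nonneg fun t => sq_nonneg _
    have habs : |q (a, y)| ≤ √X * √(∫ t in Ioc (0 : ℝ) 1, L.eval t ^ 2) := by
      rw [← integral_reproducing_of_mem_Qk hL hq a u y,
        intervalIntegral.integral_of_le zero_le_one]
      refine (abs_integral_le_integral_abs).trans ?_
      simpa only [abs_mul] using hcs
    calc q (a, y) ^ 2 = |q (a, y)| ^ 2 := (sq_abs _).symm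
      _ ≤ (√X * √(∫ t in Ioc (0 : ℝ) 1, L.eval t ^ 2)) ^ 2 := by gcongr
      _ = X * ∫ t in Ioc (0 : ℝ) 1, L.eval t ^ 2 := by
          rw [mul_pow, Real.sq_sqrt hX0, Real.sq_sqrt (integral_nonneg fun t => sq_nonneg _)]
      _ ≤ X * M ^ 2 := by gcongr
      _ = M ^ 2 * X := mul_comm _ _
  have hint := integrableOn_prod_of_continuousOn hI.subset_Icc hJ (f := fun x => q x ^ 2)
    (Continuous.continuousOn (by fun_prop))
  have hint2 := hint.integral_prod_right
  rw [Measure.volume_eq_prod, ← Measure.prod_restrict, integral_prod_symm _ hint,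
    ← integral_const_mul, ← integral_const_mul]
  refine integral_mono_of_nonneg (ae_of_all _ fun y => by positivity) (hint2.const_mul _)
    (ae_of_all _ fun y => ?_)
  simp only [hI.setIntegral]
  calc |u| * q (a, y) ^ 2 ≤ |u| * (M ^ 2 * ∫ t in (0 : ℝ)..1, q (a + u * t, y) ^ 2) := by
        gcongr; exact hpt y
    _ = _ := by ring


/-! ### The estimate on a pair of neighbouring rectangles -/

theorem kHat_le (k : ℕ) : kHat k ≤ k + 1 := by
  unfold kHat; split_ifs <;> omega

theorem memLp_two_of_continuousOn_Icc_prod {a b c d : ℝ} {f : ℝ × ℝ → ℝ}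
    (hf : ContinuousOn f (Icc a b ×ˢ Icc c d)) :
    MemLp f 2 (volume.restrict (Ioo a b ×ˢ Ioo c d)) := by
  have hK : IsCompact (Icc a b ×ˢ Icc c d) := isCompact_Icc.prod isCompact_Icc
  have : IsFiniteMeasure (volume.restrict (Icc a b ×ˢ Icc c d)) :=
    ⟨by simpa using hK.measure_lt_top⟩
  obtain ⟨B, hB⟩ := hK.exists_bound_of_continuousOn hf
  have h : MemLp f 2 (volume.restrict (Icc a b ×ˢ Icc c d)) :=
    MemLp.of_bound (hf.aestronglyMeasurable hK.measurableSet) B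
      ((ae_restrict_iff' hK.measurableSet).mpr (ae_of_all _ hB))
  exact h.mono_measure (Measure.restrict_mono
    (Set.prod_mono Ioo_subset_Icc_self Ioo_subset_Icc_self) le_rfl)

/-- Two neighbouring rectangles fill the enclosing rectangle up to the null set on their common
edge. -/
theorem Ioo_prod_union_ae_eq {a b e : ℝ} (hab : a < b) (hbe : b < e) (J : Set ℝ) :
    (Ioo a b ×ˢ J ∪ Ioo b e ×ˢ J : Set (ℝ × ℝ)) =ᵐ[volume] (Ioo a e ×ˢ J : Set (ℝ × ℝ)) := by
  rw [← Set.union_prod, Measure.volume_eq_prod]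
  refine Measure.set_prod_ae_eq ?_ EventuallyEq.rfl
  rw [← Ioc_union_Ioo_eq_Ioo hab.le hbe]
  exact ae_eq_set_union Ioo_ae_eq_Ioc EventuallyEq.rfl

/-- The trace inequality from both sides, with the edge norm written as an integral over the
enclosing rectangle of width `2h`; in this form it contains no power of `h`. -/
theorem edge_sq_add_le {k : ℕ} {L : ℝ[X]} (hL : IsReproducing k L) {M : ℝ}
    (hM : ∀ t ∈ Icc (0 : ℝ) 1, |L.eval t| ≤ M) {a h c d : ℝ} (hh : 0 < h)
    {v₁ v₂ : ℝ × ℝ → ℝ} (hv₁ : v₁ ∈ Qk k) (hv₂ : v₂ ∈ Qk k) :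
    ∫ p in Ioo (a - h) (a + h) ×ˢ Ioo c d, (v₂ (a, p.2) - v₁ (a, p.2)) ^ 2 ≤
      (2 * M) ^ 2 * ((∫ p in Ioo (a - h) a ×ˢ Ioo c d, v₁ p ^ 2) +
        ∫ p in Ioo a (a + h) ×ˢ Ioo c d, v₂ p ^ 2) := by
  have hc₁ := continuous_of_mem_Qk hv₁
  have hc₂ := continuous_of_mem_Qk hv₂
  have hl : IsSideOf (Ioo (a - h) a) a (-h) := Or.inr ⟨by linarith, by rw [← sub_eq_add_neg]⟩
  have hr : IsSideOf (Ioo a (a + h)) a h := Or.inl ⟨hh, rfl⟩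
  have h1 := integral_edge_sq_le hL hM hl (Ioo_subset_Icc_self (a := c) (b := d)) hv₁
  have h2 := integral_edge_sq_le hL hM hr (Ioo_subset_Icc_self (a := c) (b := d)) hv₂
  rw [abs_neg, abs_of_pos hh] at h1
  rw [abs_of_pos hh] at h2
  have hi : ∀ f : ℝ → ℝ, Continuous f → IntegrableOn f (Ioo c d) := fun f hf =>
    (hf.continuousOn.integrableOn_Icc).mono_set Ioo_subset_Icc_self
  have e := setIntegral_prod_mul (μ := (volume : Measure ℝ)) (ν := (volume : Measure ℝ))
    (fun _ : ℝ => (1 : ℝ)) (fun y => (v₂ (a, y) - v₁ (a, y)) ^ 2) (Ioo (a - h) (a + h)) (Ioo c d)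
  rw [← Measure.volume_eq_prod] at e
  simp only [one_mul] at e
  have hlen : ∫ _ in Ioo (a - h) (a + h), (1 : ℝ) = 2 * h := by
    rw [setIntegral_const, measureReal_def, Real.volume_Ioo,
      ENNReal.toReal_ofReal (by linarith)]
    simp; ring
  rw [e, hlen]
  have h3 : ∫ y in Ioo c d, (v₂ (a, y) - v₁ (a, y)) ^ 2 ≤
      2 * (∫ y in Ioo c d, v₂ (a, y) ^ 2) + 2 * ∫ y in Ioo c d, v₁ (a, y) ^ 2 := by
    rw [← integral_const_mul, ← integral_const_mul,
      ← integral_add (hi _ (by fun_prop)) (hi _ (by fun_prop))]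
    refine integral_mono (hi _ (by fun_prop)) (hi _ (by fun_prop)) fun y => ?_
    dsimp only
    nlinarith [sq_nonneg (v₂ (a, y) + v₁ (a, y))]
  nlinarith [mul_le_mul_of_nonneg_left h3 hh.le]

/-- The estimate across the line `x = a` between two rectangles of equal width `h`, in terms of the
local projections `q₁`, `q₂` of `z` and of the polynomials `v₁`, `v₂` that agree with the discrete
function on the left and on the right. -/
theorem abs_integral_interface_le {k : ℕ} {L : ℝ[X]} (hL : IsReproducing k L) {M : ℝ} (hM0 : 0 < M)
    (hM : ∀ t ∈ Icc (0 : ℝ) 1, |L.eval t| ≤ M) {a h c d : ℝ} (hh : 0 < h) (hcd : c < d)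
    {z q₁ q₂ v₁ v₂ : ℝ × ℝ → ℝ}
    (hz : ContDiffOn ℝ ((k + 2 : ℕ) : WithTop ℕ∞) z (Icc (a - h) (a + h) ×ˢ Icc c d))
    (hq₁ : IsL2Proj k (Ioo (a - h) a ×ˢ Ioo c d) z q₁)
    (hq₂ : IsL2Proj k (Ioo a (a + h) ×ˢ Ioo c d) z q₂) (hv₁ : v₁ ∈ Qk k) (hv₂ : v₂ ∈ Qk k) :
    |∫ y in Ioo c d, (z (a, y) - (q₂ (a, y) + q₁ (a, y)) / 2) * (v₂ (a, y) - v₁ (a, y))| ≤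
      2 * M * (1 + M) * (h ^ kHat k * normL2 (Ioo (a - h) a ×ˢ Ioo c d ∪ Ioo a (a + h) ×ˢ Ioo c d)
        (dX (kHat k + 1) z)) *
      √((∫ p in Ioo (a - h) a ×ˢ Ioo c d, v₁ p ^ 2) +
        ∫ p in Ioo a (a + h) ×ˢ Ioo c d, v₂ p ^ 2) := by
  set S := Icc (a - h) (a + h) ×ˢ Icc c d with hS
  set J := Ioo c d with hJ
  set m := kHat k with hm
  have hmk : m + 1 ≤ k + 2 := by have := kHat_le k; omega
  have hJc : J ⊆ Icc c d := Ioo_subset_Icc_self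
  have hUD : UniqueDiffOn ℝ S :=
    (uniqueDiffOn_Icc (by linarith)).prod (uniqueDiffOn_Icc hcd)
  set G := derivFst S z (m + 1) with hG
  have hGc : ContinuousOn G S := continuousOn_derivFst hUD hz hmk
  have hzc : ContinuousOn z S := hz.continuousOn
  have hl : IsSideOf (Ioo (a - h) a) a (-h) := Or.inr ⟨by linarith, by rw [← sub_eq_add_neg]⟩
  have hr : IsSideOf (Ioo a (a + h)) a h := Or.inl ⟨hh, rfl⟩
  have hw : v₂ - v₁ ∈ Qk k := (Qk k).sub_mem hv₂ hv₁
  have hwc := continuous_of_mem_Qk hw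
  have haS : a ∈ Icc (a - h) (a + h) := ⟨by linarith, by linarith⟩
  have hi : ∀ f : ℝ → ℝ, ContinuousOn f (Icc c d) → IntegrableOn f J := fun f hf =>
    hf.integrableOn_Icc.mono_set hJc
  obtain ⟨hi₁, he₁⟩ := integral_edge_proj hL hl hJc (by rwa [abs_neg, abs_of_pos hh]) hq₁ hw
  obtain ⟨hi₂, he₂⟩ := integral_edge_proj hL hr hJc (by rwa [abs_of_pos hh]) hq₂ hw
  set Z₁ : ℝ → ℝ := fun y => ∫ t in (0 : ℝ)..1, z (a + -h * t, y) * L.eval t with hZ₁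
  set Z₂ : ℝ → ℝ := fun y => ∫ t in (0 : ℝ)..1, z (a + h * t, y) * L.eval t with hZ₂
  set W : ℝ → ℝ := fun y => (v₂ - v₁) (a, y) with hW
  have hWc : Continuous W := by fun_prop
  have hiz : IntegrableOn (fun y => z (a, y) * W y) J := by
    refine hi _ (ContinuousOn.mul ?_ hWc.continuousOn)
    exact hzc.comp (by fun_prop) fun y hy => Set.mk_mem_prod haS hy
  have hq₁c := continuous_of_mem_Qk hq₁.1
  have hq₂c := continuous_of_mem_Qk hq₂.1
  have hiq₁ : IntegrableOn (fun y => q₁ (a, y) * W y) J := hi _ (by fun_prop)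
  have hiq₂ : IntegrableOn (fun y => q₂ (a, y) * W y) J := hi _ (by fun_prop)
  have hreplace : ∫ y in J, (z (a, y) - (q₂ (a, y) + q₁ (a, y)) / 2) * (v₂ (a, y) - v₁ (a, y)) =
      ∫ y in J, (z (a, y) - (Z₂ y + Z₁ y) / 2) * W y := by
    calc _ = ∫ y in J, (z (a, y) * W y - (q₂ (a, y) * W y + q₁ (a, y) * W y) / 2) := by
          congr 1; ext y; simp only [hW, Pi.sub_apply]; ring
      _ = ∫ y in J, (z (a, y) * W y - (Z₂ y * W y + Z₁ y * W y) / 2) := by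
          have hs₁ : IntegrableOn (fun y => (q₂ (a, y) * W y + q₁ (a, y) * W y) / 2) J :=
            (hiq₂.add hiq₁).div_const 2
          have hs₂ : IntegrableOn (fun y => (Z₂ y * W y + Z₁ y * W y) / 2) J :=
            (hi₂.add hi₁).div_const 2
          rw [integral_sub hiz hs₁, integral_sub hiz hs₂, integral_div, integral_div,
            integral_add hiq₂ hiq₁, integral_add hi₂ hi₁, he₁, he₂]
      _ = _ := by congr 1; ext y; ring
  have hpt : ∀ y ∈ J, ‖(z (a, y) - (Z₂ y + Z₁ y) / 2) * W y‖ ≤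
      (1 + M) * h ^ m * ∫ s in Ioo (a - h) (a + h), |G (s, y)| * |W y| := by
    intro y hy
    rw [norm_mul, integral_mul_const, ← mul_assoc]
    refine mul_le_mul_of_nonneg_right ?_ (norm_nonneg _)
    exact abs_sub_integral_reproducing_le hL hM hh (fun r s => derivFst S z r (s, y))
      (fun r hr s hs => hasDerivWithinAt_derivFst hUD hz (by omega) hs (hJc hy))
      (hGc.comp (by fun_prop) fun s hs => Set.mk_mem_prod hs (hJc hy))
  have hGi := integrableOn_prod_of_continuousOn Ioo_subset_Icc_self hJc
    (f := fun p => |G p| * |W p.2|) (hGc.abs.mul (Continuous.continuousOn (by fun_prop)))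
  have hfub : ∫ y in J, ∫ s in Ioo (a - h) (a + h), |G (s, y)| * |W y| =
      ∫ p in Ioo (a - h) (a + h) ×ˢ J, |G p| * |W p.2| := by
    rw [Measure.volume_eq_prod, ← Measure.prod_restrict, integral_prod_symm _ hGi]
  have hnorm : ∫ p in Ioo (a - h) (a + h) ×ˢ J, G p ^ 2 =
      ∫ p in Ioo (a - h) a ×ˢ J ∪ Ioo a (a + h) ×ˢ J, dX (m + 1) z p ^ 2 := by
    rw [Measure.restrict_congr_set (Ioo_prod_union_ae_eq (by linarith) (by linarith) J)]
    refine setIntegral_congr_fun (measurableSet_Ioo.prod measurableSet_Ioo) fun p hp => ?_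
    change G p ^ 2 = dX (m + 1) z (p.1, p.2) ^ 2
    rw [dX_eq_derivFst hUD hz hmk hp.1 (hJc hp.2)]
  rw [hreplace, ← Real.norm_eq_abs]
  calc _ ≤ ∫ y in J, (1 + M) * h ^ m * ∫ s in Ioo (a - h) (a + h), |G (s, y)| * |W y| :=
        norm_integral_le_of_norm_le (hGi.integral_prod_right.const_mul _)
          ((ae_restrict_iff' measurableSet_Ioo).2 (ae_of_all _ hpt))
    _ = (1 + M) * h ^ m * ∫ p in Ioo (a - h) (a + h) ×ˢ J, |G p| * |W p.2| := by
        rw [integral_const_mul, hfub]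
    _ ≤ (1 + M) * h ^ m * (√(∫ p in Ioo (a - h) (a + h) ×ˢ J, G p ^ 2) *
          √(∫ p in Ioo (a - h) (a + h) ×ˢ J, W p.2 ^ 2)) := by
        gcongr
        exact integral_abs_mul_abs_le (memLp_two_of_continuousOn_Icc_prod hGc)
          (memLp_two_of_continuousOn_Icc_prod (f := fun p => W p.2)
            (Continuous.continuousOn (by fun_prop)))
    _ ≤ (1 + M) * h ^ m * (√(∫ p in Ioo (a - h) (a + h) ×ˢ J, G p ^ 2) *
          (2 * M * √((∫ p in Ioo (a - h) a ×ˢ J, v₁ p ^ 2) +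
            ∫ p in Ioo a (a + h) ×ˢ J, v₂ p ^ 2))) := by
        gcongr
        refine (Real.sqrt_le_sqrt (edge_sq_add_le hL hM hh hv₁ hv₂)).trans_eq ?_
        rw [Real.sqrt_mul (sq_nonneg _), Real.sqrt_sq (by positivity)]
    _ = _ := by rw [hnorm, normL2]; ring


/-! ### Averages and jumps as one-sided limits -/

theorem limUnder_nhdsGT_eq {a b : ℝ} (hab : a < b) {φ ψ : ℝ → ℝ} (h : EqOn φ ψ (Ioo a b))
    (hψ : ContinuousOn ψ (Icc a b)) : limUnder (𝓝[>] a) φ = ψ a := by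
  refine Tendsto.limUnder_eq (Tendsto.congr' ?_ (f₁ := ψ) ?_)
  · filter_upwards [Ioo_mem_nhdsGT hab] with s hs using (h hs).symm
  · have := (hψ a (left_mem_Icc.2 hab.le)).mono Ioo_subset_Icc_self
    rwa [ContinuousWithinAt, nhdsWithin_Ioo_eq_nhdsGT hab] at this

theorem limUnder_nhdsLT_eq {a b : ℝ} (hab : a < b) {φ ψ : ℝ → ℝ} (h : EqOn φ ψ (Ioo a b))
    (hψ : ContinuousOn ψ (Icc a b)) : limUnder (𝓝[<] b) φ = ψ b := by
  refine Tendsto.limUnder_eq (Tendsto.congr' ?_ (f₁ := ψ) ?_)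
  · filter_upwards [Ioo_mem_nhdsLT hab] with s hs using (h hs).symm
  · have := (hψ b (right_mem_Icc.2 hab.le)).mono Ioo_subset_Icc_self
    rwa [ContinuousWithinAt, nhdsWithin_Ioo_eq_nhdsLT hab] at this

theorem normL2_sq_union {D E : Set (ℝ × ℝ)} (hDE : Disjoint D E) (hD : MeasurableSet D)
    (hE : MeasurableSet E) {v v₁ v₂ : ℝ × ℝ → ℝ} (h₁ : EqOn v v₁ D) (h₂ : EqOn v v₂ E)
    (hi₁ : IntegrableOn (fun p => v₁ p ^ 2) D) (hi₂ : IntegrableOn (fun p => v₂ p ^ 2) E) :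
    normL2 (D ∪ E) v = √((∫ p in D, v₁ p ^ 2) + ∫ p in E, v₂ p ^ 2) := by
  have e₁ : EqOn (fun p => v₁ p ^ 2) (fun p => v p ^ 2) D := fun p hp => by simp only [h₁ hp]
  have e₂ : EqOn (fun p => v₂ p ^ 2) (fun p => v p ^ 2) E := fun p hp => by simp only [h₂ hp]
  rw [normL2, setIntegral_union hDE hE (hi₁.congr_fun e₁ hD) (hi₂.congr_fun e₂ hE),
    setIntegral_congr_fun hD e₁, setIntegral_congr_fun hE e₂]

/-- The estimate across the line `x = a`, with averages and jumps defined by one-sided limits;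
`π` is any function that agrees with the local projections of `z`. -/
theorem abs_integral_avgX_mul_jumpX_le {k : ℕ} {L : ℝ[X]} (hL : IsReproducing k L) {M : ℝ}
    (hM0 : 0 < M) (hM : ∀ t ∈ Icc (0 : ℝ) 1, |L.eval t| ≤ M) {a h c d : ℝ} (hh : 0 < h)
    (hcd : c < d) {z π q₁ q₂ v v₁ v₂ : ℝ × ℝ → ℝ}
    (hz : ContDiffOn ℝ ((k + 2 : ℕ) : WithTop ℕ∞) z (Icc (a - h) (a + h) ×ˢ Icc c d))
    (hq₁ : IsL2Proj k (Ioo (a - h) a ×ˢ Ioo c d) z q₁)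
    (hq₂ : IsL2Proj k (Ioo a (a + h) ×ˢ Ioo c d) z q₂)
    (hπ₁ : EqOn π q₁ (Ioo (a - h) a ×ˢ Ioo c d)) (hπ₂ : EqOn π q₂ (Ioo a (a + h) ×ˢ Ioo c d))
    (hv₁ : v₁ ∈ Qk k) (hv₂ : v₂ ∈ Qk k)
    (hvv₁ : EqOn v v₁ (Ioo (a - h) a ×ˢ Ioo c d)) (hvv₂ : EqOn v v₂ (Ioo a (a + h) ×ˢ Ioo c d)) :
    |∫ y in Ioo c d, avgX (z - π) a y * jumpX v a y| ≤
      2 * M * (1 + M) *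
        (h ^ kHat k * normL2 (Ioo (a - h) a ×ˢ Ioo c d ∪ Ioo a (a + h) ×ˢ Ioo c d)
          (dX (kHat k + 1) z) +
        h ^ (k + 1) * normL2 (Ioo (a - h) a ×ˢ Ioo c d ∪ Ioo a (a + h) ×ˢ Ioo c d)
          (dX (k + 2) z)) *
      normL2 (Ioo (a - h) a ×ˢ Ioo c d ∪ Ioo a (a + h) ×ˢ Ioo c d) v := by
  have hl : a - h < a := by linarith
  have hr : a < a + h := by linarith
  have hzl : ∀ y ∈ Ioo c d, ContinuousOn (fun s => z (s, y)) (Icc (a - h) (a + h)) := fun y hy =>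
    hz.continuousOn.comp (by fun_prop) fun s hs => Set.mk_mem_prod hs (Ioo_subset_Icc_self hy)
  have hq₁c := continuous_of_mem_Qk hq₁.1
  have hq₂c := continuous_of_mem_Qk hq₂.1
  have hv₁c := continuous_of_mem_Qk hv₁
  have hv₂c := continuous_of_mem_Qk hv₂
  have hcongr : ∀ y ∈ Ioo c d, avgX (z - π) a y * jumpX v a y =
      (z (a, y) - (q₂ (a, y) + q₁ (a, y)) / 2) * (v₂ (a, y) - v₁ (a, y)) := by
    intro y hy
    have t₁ : traceXMinus (z - π) a y = z (a, y) - q₁ (a, y) :=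
      limUnder_nhdsLT_eq hl (ψ := fun s => z (s, y) - q₁ (s, y))
        (fun s hs => by simp only [Pi.sub_apply]; rw [hπ₁ (Set.mk_mem_prod hs hy)])
        (((hzl y hy).mono (Icc_subset_Icc_right hr.le)).sub
          (Continuous.continuousOn (by fun_prop)))
    have t₂ : traceXPlus (z - π) a y = z (a, y) - q₂ (a, y) :=
      limUnder_nhdsGT_eq hr (ψ := fun s => z (s, y) - q₂ (s, y))
        (fun s hs => by simp only [Pi.sub_apply]; rw [hπ₂ (Set.mk_mem_prod hs hy)])
        (((hzl y hy).mono (Icc_subset_Icc_left hl.le)).sub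
          (Continuous.continuousOn (by fun_prop)))
    have t₃ : traceXMinus v a y = v₁ (a, y) :=
      limUnder_nhdsLT_eq hl (ψ := fun s => v₁ (s, y)) (fun s hs => hvv₁ (Set.mk_mem_prod hs hy))
        (Continuous.continuousOn (by fun_prop))
    have t₄ : traceXPlus v a y = v₂ (a, y) :=
      limUnder_nhdsGT_eq hr (ψ := fun s => v₂ (s, y)) (fun s hs => hvv₂ (Set.mk_mem_prod hs hy))
        (Continuous.continuousOn (by fun_prop))
    rw [avgX, jumpX, t₁, t₂, t₃, t₄]
    ring
  have hdisj : Disjoint (Ioo (a - h) a ×ˢ Ioo c d) (Ioo a (a + h) ×ˢ Ioo c d) := by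
    refine Set.disjoint_left.2 fun p hp hp' => ?_
    exact lt_asymm hp.1.2 hp'.1.1
  rw [setIntegral_congr_fun measurableSet_Ioo hcongr,
    normL2_sq_union hdisj (measurableSet_Ioo.prod measurableSet_Ioo)
      (measurableSet_Ioo.prod measurableSet_Ioo) hvv₁ hvv₂
      (memLp_of_mem_Qk hv₁ _ _ _ _).integrable_sq (memLp_of_mem_Qk hv₂ _ _ _ _).integrable_sq]
  refine (abs_integral_interface_le hL hM0 hM hh hcd hz hq₁ hq₂ hv₁ hv₂).trans ?_
  gcongr
  exact le_add_of_nonneg_right (mul_nonneg (by positivity) (Real.sqrt_nonneg _))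

/-! ### Exchanging the coordinates -/

theorem comp_swap_mem_Qk {k : ℕ} {q : ℝ × ℝ → ℝ} (hq : q ∈ Qk k) : q ∘ Prod.swap ∈ Qk k := by
  induction hq using Submodule.span_induction with
  | mem f hf =>
    obtain ⟨mn, rfl⟩ := hf
    refine Submodule.subset_span ⟨mn.swap, ?_⟩
    ext p
    exact mul_comm _ _
  | zero => exact (Qk k).zero_mem
  | add f g _ _ hf hg => exact (Qk k).add_mem hf hg
  | smul c f _ hf => exact (Qk k).smul_mem c hf

theorem setIntegral_comp_swap (A B : Set ℝ) (f : ℝ × ℝ → ℝ) :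
    ∫ p in B ×ˢ A, f p.swap = ∫ p in A ×ˢ B, f p := by
  rw [Measure.volume_eq_prod]
  exact setIntegral_prod_swap A B f

theorem IsL2Proj.comp_swap {k : ℕ} {A B : Set ℝ} {z q : ℝ × ℝ → ℝ}
    (h : IsL2Proj k (A ×ˢ B) z q) :
    IsL2Proj k (B ×ˢ A) (z ∘ Prod.swap) (q ∘ Prod.swap) := by
  refine ⟨comp_swap_mem_Qk h.1, fun w hw => ?_⟩
  have h' := h.2 _ (comp_swap_mem_Qk hw)
  rw [← setIntegral_comp_swap, ← setIntegral_comp_swap A B] at h'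
  exact h'

theorem normL2_comp_swap (A A' B : Set ℝ) (f : ℝ × ℝ → ℝ) :
    normL2 (A ×ˢ B ∪ A' ×ˢ B) (f ∘ Prod.swap) = normL2 (B ×ˢ A ∪ B ×ˢ A') f := by
  rw [normL2, normL2, ← Set.union_prod, ← Set.prod_union,
    ← setIntegral_comp_swap B (A ∪ A') fun p => f p ^ 2]
  rfl

/-! ### The mesh and the piecewise projection -/

theorem tau_pos {ε σ β : ℝ} (hε : 0 < ε) (hσ : 0 < σ) (hβ : 0 < β) {N : ℕ} (hN : 4 ≤ N) :
    0 < tau ε σ β N := by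
  have : 0 < Real.log N := Real.log_pos (by exact_mod_cast (by omega : 1 < N))
  have : 0 < √ε := Real.sqrt_pos.2 hε
  exact lt_min (by positivity) (by norm_num)

theorem meshPt_lt_succ {ε σ β : ℝ} (hε : 0 < ε) (hσ : 0 < σ) (hβ : 0 < β) {N : ℕ} (hN : 4 ≤ N)
    (h4 : 4 ∣ N) {n : ℕ} (hn : n < N) : meshPt ε σ β N n < meshPt ε σ β N (n + 1) := by
  have ht := tau_pos hε hσ hβ hN
  have ht' : tau ε σ β N ≤ 1 / 4 := min_le_right _ _
  obtain ⟨m, rfl⟩ := h4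
  have hm : (0 : ℝ) < m := by exact_mod_cast (by omega : 0 < m)
  unfold meshPt
  set t := tau ε σ β (4 * m)
  push_cast
  have h1 : ∀ s : ℝ, s / (4 * m) = s / m / 4 := fun s => by field_simp
  have hstep : ((n : ℝ) + 1) / m = n / m + 1 / m := add_div _ _ _
  have hpos : 0 < 1 / (m : ℝ) := by positivity
  have hN1 : 4 * t * (n : ℝ) / (4 * m) = t * (n / m) := by field_simp
  have hN2 : 4 * t * ((n : ℝ) + 1) / (4 * m) = t * (n / m + 1 / m) := by field_simp
  rw [hN1, hN2, h1, h1, hstep]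
  -- adjacent formulas agree at the transition points `n = m` and `n = 3m`
  split_ifs with a1 a2 a3 a4 a5 a6 a7 a8
  · nlinarith
  · obtain rfl : n = m := by omega
    rw [div_self hm.ne']; nlinarith
  · omega
  · omega
  · nlinarith
  · have : (n : ℝ) = 3 * m := by exact_mod_cast (by omega : n = 3 * m)
    rw [this, mul_div_assoc, div_self hm.ne']; nlinarith
  · omega
  · omega
  · nlinarith

theorem disjoint_cell {x : ℕ → ℝ} {N : ℕ} (hx : ∀ n < N, x n < x (n + 1)) {i i' : ℕ}
    (hi : i ≤ N) (hi' : i' ≤ N) (hne : i ≠ i') : Disjoint (cell x i) (cell x i') := by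
  have hmono : ∀ m n, m ≤ n → n ≤ N → x m ≤ x n := by
    intro m n hmn
    induction n, hmn using Nat.le_induction with
    | base => exact fun _ => le_rfl
    | succ n _ ih => exact fun hn => (ih (by omega)).trans (hx n (by omega)).le
  refine Set.disjoint_left.2 fun s hs hs' => ?_
  rcases Nat.lt_or_gt_of_ne hne with h | h
  · exact absurd (hs.2.trans_le (hmono i (i' - 1) (by omega) (by omega))) (lt_asymm hs'.1)
  · exact absurd (hs'.2.trans_le (hmono i' (i - 1) (by omega) (by omega))) (lt_asymm hs.1)

theorem piProj_eqOn {x : ℕ → ℝ} {N : ℕ} (hx : ∀ n < N, x n < x (n + 1)) (k : ℕ) {i j : ℕ}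
    (hi : 1 ≤ i) (hiN : i ≤ N) (hj : 1 ≤ j) (hjN : j ≤ N) (z : ℝ × ℝ → ℝ) :
    EqOn (piProj k x N z) (localProj k (elt x i j) z) (elt x i j) := by
  intro p hp
  rw [piProj, Finset.sum_eq_single i, Finset.sum_eq_single j, Set.indicator_of_mem hp]
  · intro j' hj' hne
    refine Set.indicator_of_notMem (fun h => ?_) _
    exact Set.disjoint_left.1 (disjoint_cell hx (Finset.mem_Icc.1 hj').2 hjN hne) h.2 hp.2
  · exact fun h => absurd (Finset.mem_Icc.2 ⟨hj, hjN⟩) h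
  · intro i' hi' hne
    refine Finset.sum_eq_zero fun j' _ => Set.indicator_of_notMem (fun h => ?_) _
    exact Set.disjoint_left.1 (disjoint_cell hx (Finset.mem_Icc.1 hi').2 hiN hne) h.1 hp.1
  · exact fun h => absurd (Finset.mem_Icc.2 ⟨hi, hiN⟩) h

theorem isL2Proj_localProj (k : ℕ) {a b c d : ℝ} (hab : a < b) (hcd : c < d) {z : ℝ × ℝ → ℝ}
    (hz : ContinuousOn z (closure (Ioo a b ×ˢ Ioo c d))) :
    IsL2Proj k (Ioo a b ×ˢ Ioo c d) z (localProj k (Ioo a b ×ˢ Ioo c d) z) := by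
  rw [closure_prod_eq, closure_Ioo hab.ne, closure_Ioo hcd.ne] at hz
  have h : ∃ q, IsL2Proj k (Ioo a b ×ˢ Ioo c d) z q :=
    (existsUnique_isL2Proj k hab hcd (memLp_two_of_continuousOn_Icc_prod hz)).exists
  rw [localProj, dif_pos h]
  exact h.choose_spec

end LDG

theorem lemma4p1 (k : ℕ) :
    ∃ C : ℝ, 0 < C ∧
      ∀ (ε σ β : ℝ), 0 < ε → 0 < σ → 0 < β →
      ∀ N : ℕ, 4 ≤ N → 4 ∣ N →
      ∀ x : ℕ → ℝ, x = LDG.meshPt ε σ β N →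
        (∀ i j : ℕ, 1 ≤ i → i + 1 ≤ N → 1 ≤ j → j ≤ N →
          LDG.width x i = LDG.width x (i + 1) →
          ∀ z : ℝ × ℝ → ℝ,
            ContDiffOn ℝ ((k + 2 : ℕ) : WithTop ℕ∞) z
              (closure (LDG.elt x i j) ∪ closure (LDG.elt x (i + 1) j)) →
            ∀ v ∈ LDG.FESpace k x N,
              |∫ y in LDG.cell x j,
                  LDG.avgX (z - LDG.piProj k x N z) (x i) y * LDG.jumpX v (x i) y| ≤
                C * (LDG.width x i ^ LDG.kHat k *
                      LDG.normL2 (LDG.elt x i j ∪ LDG.elt x (i + 1) j)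
                        (LDG.dX (LDG.kHat k + 1) z) +
                    LDG.width x i ^ (k + 1) *
                      LDG.normL2 (LDG.elt x i j ∪ LDG.elt x (i + 1) j) (LDG.dX (k + 2) z)) *
                  LDG.normL2 (LDG.elt x i j ∪ LDG.elt x (i + 1) j) v) ∧
        (∀ i j : ℕ, 1 ≤ i → i ≤ N → 1 ≤ j → j + 1 ≤ N →
          LDG.width x j = LDG.width x (j + 1) →
          ∀ z : ℝ × ℝ → ℝ,
            ContDiffOn ℝ ((k + 2 : ℕ) : WithTop ℕ∞) z
              (closure (LDG.elt x i j) ∪ closure (LDG.elt x i (j + 1))) →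
            ∀ v ∈ LDG.FESpace k x N,
              |∫ s in LDG.cell x i,
                  LDG.avgY (z - LDG.piProj k x N z) (x j) s * LDG.jumpY v (x j) s| ≤
                C * (LDG.width x j ^ LDG.kHat k *
                      LDG.normL2 (LDG.elt x i j ∪ LDG.elt x i (j + 1))
                        (LDG.dY (LDG.kHat k + 1) z) +
                    LDG.width x j ^ (k + 1) *
                      LDG.normL2 (LDG.elt x i j ∪ LDG.elt x i (j + 1)) (LDG.dY (k + 2) z)) *
                  LDG.normL2 (LDG.elt x i j ∪ LDG.elt x i (j + 1)) v) := by
  obtain ⟨L, hL⟩ := LDG.exists_isReproducing k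
  obtain ⟨M, hM0, hM⟩ := LDG.exists_bound_eval L
  refine ⟨2 * M * (1 + M), by positivity, ?_⟩
  intro ε σ β hε hσ hβ N hN h4 x hx
  have hmesh : ∀ n < N, x n < x (n + 1) := fun n hn => by
    rw [hx]; exact LDG.meshPt_lt_succ hε hσ hβ hN h4 hn
  have hcell : ∀ i, 1 ≤ i → i ≤ N → x (i - 1) < x i := fun i hi hiN => by
    have := hmesh (i - 1) (by omega)
    rwa [Nat.sub_add_cancel hi] at this
  -- two neighbouring cells of equal width, written as the intervals to the left and right of `x i`
  have hpair : ∀ i, LDG.width x i = LDG.width x (i + 1) →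
      LDG.cell x i = Ioo (x i - LDG.width x i) (x i) ∧
      LDG.cell x (i + 1) = Ioo (x i) (x i + LDG.width x i) := by
    intro i hw
    refine ⟨by simp [LDG.cell, LDG.width], ?_⟩
    rw [hw]; simp [LDG.cell, LDG.width]
  have hwpos : ∀ i, 1 ≤ i → i ≤ N → 0 < LDG.width x i := fun i hi hiN =>
    sub_pos.2 (hcell i hi hiN)
  have hclosure : ∀ i j, 1 ≤ i → i ≤ N → 1 ≤ j → j ≤ N →
      closure (LDG.elt x i j) = Icc (x (i - 1)) (x i) ×ˢ Icc (x (j - 1)) (x j) := by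
    intro i j hi hiN hj hjN
    rw [LDG.elt, LDG.cell, LDG.cell, closure_prod_eq, closure_Ioo (hcell i hi hiN).ne,
      closure_Ioo (hcell j hj hjN).ne]
  have hIcc : ∀ i, 1 ≤ i → i + 1 ≤ N → LDG.width x i = LDG.width x (i + 1) →
      Icc (x (i - 1)) (x i) ∪ Icc (x i) (x (i + 1)) =
        Icc (x i - LDG.width x i) (x i + LDG.width x i) := by
    intro i hi hiN hw
    rw [Icc_union_Icc_eq_Icc (hcell i hi (by omega)).le (hmesh i (by omega)).le]
    nth_rw 2 [hw]
    simp [LDG.width]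
  have hproj : ∀ i j, 1 ≤ i → i ≤ N → 1 ≤ j → j ≤ N → ∀ z : ℝ × ℝ → ℝ,
      ContinuousOn z (closure (LDG.elt x i j)) →
      LDG.IsL2Proj k (LDG.elt x i j) z (LDG.localProj k (LDG.elt x i j) z) :=
    fun i j hi hiN hj hjN z hz =>
      LDG.isL2Proj_localProj k (hcell i hi hiN) (hcell j hj hjN) hz
  refine ⟨?_, ?_⟩
  · intro i j hi hiN hj hjN hw z hz v hv
    obtain ⟨v₁, hv₁, hvv₁⟩ := hv.2 i (Finset.mem_Icc.2 ⟨hi, by omega⟩) j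
      (Finset.mem_Icc.2 ⟨hj, hjN⟩)
    obtain ⟨v₂, hv₂, hvv₂⟩ := hv.2 (i + 1) (Finset.mem_Icc.2 ⟨by omega, hiN⟩) j
      (Finset.mem_Icc.2 ⟨hj, hjN⟩)
    have hq₁ := hproj i j hi (by omega) hj hjN z (hz.continuousOn.mono subset_union_left)
    have hq₂ := hproj (i + 1) j (by omega) hiN hj hjN z (hz.continuousOn.mono subset_union_right)
    have hπ₁ := LDG.piProj_eqOn hmesh k hi (by omega) hj hjN z
    have hπ₂ := LDG.piProj_eqOn hmesh k (by omega) hiN hj hjN z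
    obtain ⟨hc₁, hc₂⟩ := hpair i hw
    rw [hclosure i j hi (by omega) hj hjN, hclosure (i + 1) j (by omega) hiN hj hjN,
      ← Set.union_prod, Nat.add_sub_cancel, hIcc i hi hiN hw] at hz
    simp only [LDG.elt, hc₁, hc₂] at *
    exact LDG.abs_integral_avgX_mul_jumpX_le hL hM0 hM (hwpos i hi (by omega)) (hcell j hj hjN)
      hz hq₁ hq₂ hπ₁ hπ₂ hv₁ hv₂ hvv₁ hvv₂
  · intro i j hi hiN hj hjN hw z hz v hv
    obtain ⟨v₁, hv₁, hvv₁⟩ := hv.2 i (Finset.mem_Icc.2 ⟨hi, hiN⟩) j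
      (Finset.mem_Icc.2 ⟨hj, by omega⟩)
    obtain ⟨v₂, hv₂, hvv₂⟩ := hv.2 i (Finset.mem_Icc.2 ⟨hi, hiN⟩) (j + 1)
      (Finset.mem_Icc.2 ⟨by omega, hjN⟩)
    have hq₁ := hproj i j hi hiN hj (by omega) z (hz.continuousOn.mono subset_union_left)
    have hq₂ := hproj i (j + 1) hi hiN (by omega) hjN z (hz.continuousOn.mono subset_union_right)
    have hπ₁ := LDG.piProj_eqOn hmesh k hi hiN hj (by omega) z
    have hπ₂ := LDG.piProj_eqOn hmesh k hi hiN (by omega) hjN z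
    obtain ⟨hc₁, hc₂⟩ := hpair j hw
    rw [hclosure i j hi hiN hj (by omega), hclosure i (j + 1) hi hiN (by omega) hjN,
      ← Set.prod_union, Nat.add_sub_cancel, hIcc j hj hjN hw] at hz
    have hz' : ContDiffOn ℝ ((k + 2 : ℕ) : WithTop ℕ∞) (z ∘ Prod.swap)
        (Icc (x j - LDG.width x j) (x j + LDG.width x j) ×ˢ Icc (x (i - 1)) (x i)) :=
      hz.comp (contDiff_snd.prodMk contDiff_fst).contDiffOn fun p hp => ⟨hp.2, hp.1⟩
    simp only [LDG.elt, hc₁, hc₂] at *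
    have key := LDG.abs_integral_avgX_mul_jumpX_le hL hM0 hM (hwpos j hj (by omega))
      (hcell i hi hiN) hz' hq₁.comp_swap hq₂.comp_swap
      (π := LDG.piProj k x N z ∘ Prod.swap) (v := v ∘ Prod.swap)
      (fun p hp => hπ₁ (Set.mk_mem_prod hp.2 hp.1)) (fun p hp => hπ₂ (Set.mk_mem_prod hp.2 hp.1))
      (LDG.comp_swap_mem_Qk hv₁) (LDG.comp_swap_mem_Qk hv₂)
      (fun p hp => hvv₁ (Set.mk_mem_prod hp.2 hp.1)) (fun p hp => hvv₂ (Set.mk_mem_prod hp.2 hp.1))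
    have hd : ∀ m, LDG.dX m (z ∘ Prod.swap) = LDG.dY m z ∘ Prod.swap := fun m => rfl
    rw [hd, hd, LDG.normL2_comp_swap, LDG.normL2_comp_swap, LDG.normL2_comp_swap] at key
    exact key
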